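/- Let $(R,\mathfrak m,k)$ be a commutative Noetherian local ring and let $I$ be an integrally closed $\mathfrak m$-primary ideal of $R$. Here $I$ is integrally closed if every $r\in R$ satisfying an equation $r^n+a_1r^{n-1}+\cdots+a_n=0$ with $n\ge 1$ and $a_i\in I^i$ for $1\le i\le n$ lies in $I$. For a finitely generated $R$-module $M$ and $n\ge 0$, let $\beta_n^R(M)=\operatorname{rank}_k\operatorname{Ext}_R^n(M,k)$. The complexity $\operatorname{cx}_R(M)$ is the smallest integer $b\ge 0$ for which there is a real number $\alpha>0$ with $\beta_n^R(M)\le\alpha n^{b-1}$ for all sufficiently large $n$, and $\operatorname{cx}_R(M)=\infty$ if no such $b$ exists. The curvature is $\operatorname{curv}_R(M)=\limsup_{n\to\infty}\sqrt[n]{\beta_n^R(M)}$. Then $I$, as an $R$-module, has maximal complexity and maximal curvature, that is, $$\operatorname{cx}_R(I)=\operatorname{cx}_R(k)\quad\text{and}\quad\operatorname{curv}_R(I)=\operatorname{curv}_R(k).$$ -/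

import Mathlib

open CategoryTheory IsLocalRing Filter

universe u

/-- `Ext_R^n(M, k)` as an `R`-module, where `k` is the residue field of the local ring `R`. -/
abbrev ExtResidueField (R : Type u) [CommRing R] [IsLocalRing R] (M : Type u) [AddCommGroup M]
    [Module R M] (n : ℕ) : Type u :=
  Abelian.Ext.{u} (ModuleCat.of R M) (ModuleCat.of R (ResidueField R)) n

/-- The maximal ideal of `R` annihilates `Ext_R^n(M, k)`. -/
theorem ExtResidueField.isTorsionBySet (R : Type u) [CommRing R] [IsLocalRing R] (M : Type u)
    [AddCommGroup M] [Module R M] (n : ℕ) :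
    Module.IsTorsionBySet R (ExtResidueField R M n) (maximalIdeal R : Set R) := by
  rintro x ⟨r, hr⟩
  have h0 : r • 𝟙 (ModuleCat.of R (ResidueField R)) = 0 := by
    ext y
    change r • y = 0
    rw [Algebra.smul_def]
    have : algebraMap R (ResidueField R) r = 0 := (residue_eq_zero_iff r).2 hr
    rw [this, zero_mul]
  change r • x = 0
  rw [Abelian.Ext.smul_eq_comp_mk₀, h0, Abelian.Ext.mk₀_zero, Abelian.Ext.comp_zero]

/-- The `k`-vector space structure on `Ext_R^n(M, k)` induced by its `R`-module structure: the
class of `r` in `k = R / 𝔪` acts as `r`. -/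
noncomputable instance ExtResidueField.module (R : Type u) [CommRing R] [IsLocalRing R]
    (M : Type u) [AddCommGroup M] [Module R M] (n : ℕ) :
    Module (ResidueField R) (ExtResidueField R M n) :=
  (ExtResidueField.isTorsionBySet R M n).module

/-- The `n`-th Betti number `β_n^R(M) = rank_k Ext_R^n(M, k)` of a finitely generated module `M`
over a Noetherian local ring `R`. -/
noncomputable def bettiNumber (R : Type u) [CommRing R] [IsLocalRing R] (M : Type u)
    [AddCommGroup M] [Module R M] (n : ℕ) : ℕ :=
  Module.finrank (ResidueField R) (ExtResidueField R M n)

/-- The complexity `cx_R(M)`: the least natural number `b` such that, for some real `α > 0`,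
`β_n^R(M) ≤ α n^(b-1)` for all large `n`; it is `∞` if there is no such `b`. The exponent `b - 1`
is an integer, equal to `-1` when `b = 0`. -/
noncomputable def complexity (R : Type u) [CommRing R] [IsLocalRing R] (M : Type u)
    [AddCommGroup M] [Module R M] : ℕ∞ :=
  ⨅ (b : ℕ) (_ : ∃ α : ℝ, 0 < α ∧
    ∀ᶠ n : ℕ in atTop, (bettiNumber R M n : ℝ) ≤ α * (n : ℝ) ^ ((b : ℤ) - 1)), (b : ℕ∞)

/-- The curvature `curv_R(M) = limsup_{n → ∞} (β_n^R(M))^(1/n)`, as an element of `[0, ∞]`. -/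
noncomputable def curvature (R : Type u) [CommRing R] [IsLocalRing R] (M : Type u)
    [AddCommGroup M] [Module R M] : ENNReal :=
  limsup (fun n : ℕ => (bettiNumber R M n : ENNReal) ^ (1 / (n : ℝ))) atTop

/-- `r` is integral over the ideal `I`: there are `n ≥ 1` and `a_i ∈ I^i` for `1 ≤ i ≤ n` with
`r^n + a_1 r^(n-1) + ⋯ + a_n = 0`. -/
def IsIntegralOverIdeal {R : Type u} [CommRing R] (I : Ideal R) (r : R) : Prop :=
  ∃ n : ℕ, 1 ≤ n ∧ ∃ a : ℕ → R, (∀ i ∈ Finset.Icc 1 n, a i ∈ I ^ i) ∧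
    r ^ n + ∑ i ∈ Finset.Icc 1 n, a i * r ^ (n - i) = 0

/-- The ideal `I` is integrally closed: it contains every ring element integral over it. -/
def IsIntegrallyClosedIdeal {R : Type u} [CommRing R] (I : Ideal R) : Prop :=
  ∀ r : R, IsIntegralOverIdeal I r → r ∈ I

/-! Each of $I$ and $k$ has Betti numbers bounded by a constant times nearby Betti numbers of the
other, and such bounds preserve growth rates. Upper bound: $R/I$ is killed by some $\mathfrak m^j$,
so it has a finite filtration with factors $k$ (`exists_bettiNumber_le_mul`), and $I$ is a syzygy of
$R/I$. Lower bound, when $\mathfrak m\ne 0$: take $y\notin I$ in the last power of $\mathfrak m$ not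
inside $I$, so $y\mathfrak m\subseteq I$. If $y\mathfrak m\subseteq I\mathfrak m$, the determinant
trick would make $y$ integral over $I$; hence $yx\notin I\mathfrak m$ for some $x\in\mathfrak m$
(`IsIntegrallyClosedIdeal.exists_mul_notMem`). Put $J=(y)+I$, so $J/I\cong k$. The projection $J\to
k$ factors as multiplication by $x$ into $I$ followed by a form $I\to k$ that is nonzero at $yx$.
The long exact sequence of $0\to I\to J\to k\to 0$ then gives
$\beta_{n+1}(k)\le\beta_n(I)+\beta_{n+1}(I)$ (`bettiNumber_residueField_succ_le_of_burch`). -/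

/-! ### Dimension counts for linear maps over the residue field. -/

section FinrankExact

variable {R k A B C : Type*} [CommRing R] [Field k] [Algebra R k]
  [AddCommGroup A] [Module R A] [Module k A] [IsScalarTower R k A]
  [AddCommGroup B] [Module R B] [Module k B] [IsScalarTower R k B]
  [AddCommGroup C] [Module R C] [Module k C] [IsScalarTower R k C]

/-- The middle dimension of a sequence of `R`-linear maps between vector spaces over a quotient
field `k` of `R` that is exact in the middle is at most the sum of the outer ones. -/
theorem finrank_le_add_of_exact [Module.Finite k A] [Module.Finite k B] [Module.Finite k C]
    (hk : Function.Surjective (algebraMap R k))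
    (f : A →ₗ[R] B) (g : B →ₗ[R] C) (h : ∀ b, g b = 0 → ∃ a, f a = b) :
    Module.finrank k B ≤ Module.finrank k A + Module.finrank k C := by
  have h1 := (g.extendScalarsOfSurjective hk).finrank_range_add_finrank_ker
  have h2 := (f.extendScalarsOfSurjective hk).finrank_range_le
  have h3 : LinearMap.ker (g.extendScalarsOfSurjective hk) ≤
      LinearMap.range (f.extendScalarsOfSurjective hk) := h
  have h4 := Submodule.finrank_mono h3
  have h5 := (LinearMap.range (g.extendScalarsOfSurjective hk)).finrank_le
  omega

theorem finrank_le_of_surjective_of_algebraMap_surjective [Module.Finite k A]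
    (hk : Function.Surjective (algebraMap R k))
    (f : A →ₗ[R] B) (h : Function.Surjective f) :
    Module.finrank k B ≤ Module.finrank k A :=
  LinearMap.finrank_le_finrank_of_surjective (f := f.extendScalarsOfSurjective hk) h

theorem finrank_le_of_injective_of_algebraMap_surjective [Module.Finite k B]
    (hk : Function.Surjective (algebraMap R k))
    (f : A →ₗ[R] B) (h : Function.Injective f) :
    Module.finrank k A ≤ Module.finrank k B :=
  LinearMap.finrank_le_finrank_of_injective (f := f.extendScalarsOfSurjective hk) h

end FinrankExact

/-! ### Long exact sequences and inequalities between Betti numbers. -/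

section Betti

theorem ModuleCat.shortExact_of_linearMap {R : Type u} [CommRing R]
    {L M N : Type u} [AddCommGroup L] [Module R L] [AddCommGroup M] [Module R M]
    [AddCommGroup N] [Module R N] {f : L →ₗ[R] M} {g : M →ₗ[R] N} (hf : Function.Injective f)
    (hfg : Function.Exact f g) (hg : Function.Surjective g) :
    (ModuleCat.shortComplexOfCompEqZero f g hfg.linearMap_comp_eq_zero).ShortExact :=
  ModuleCat.shortComplex_shortExact _ hfg hf hg

variable {R : Type u} [CommRing R] [IsLocalRing R]

instance ExtResidueField.isScalarTower (M : Type u) [AddCommGroup M] [Module R M] (n : ℕ) :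
    IsScalarTower R (ResidueField R) (ExtResidueField R M n) :=
  (ExtResidueField.isTorsionBySet R M n).isScalarTower

/-- Pullback of `Ext` classes into the residue field along a linear map. -/
noncomputable abbrev ExtResidueField.map {M N : Type u} [AddCommGroup M] [Module R M]
    [AddCommGroup N] [Module R N] (f : M →ₗ[R] N) (n : ℕ) :
    ExtResidueField R N n →ₗ[R] ExtResidueField R M n :=
  (Abelian.Ext.mk₀ (ModuleCat.ofHom f)).precompOfLinear R _ (zero_add n)

theorem ExtResidueField.map_comp_apply {M N P : Type u} [AddCommGroup M] [Module R M]
    [AddCommGroup N] [Module R N] [AddCommGroup P] [Module R P]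
    (f : M →ₗ[R] N) (g : N →ₗ[R] P) (n : ℕ) (x : ExtResidueField R P n) :
    ExtResidueField.map (g ∘ₗ f) n x = ExtResidueField.map f n (ExtResidueField.map g n x) := by
  simp [ExtResidueField.map, ModuleCat.ofHom_comp, ← Abelian.Ext.mk₀_comp_mk₀_assoc]

section ShortExact

variable {L M N : Type u} [AddCommGroup L] [Module R L] [AddCommGroup M] [Module R M]
  [AddCommGroup N] [Module R N] {f : L →ₗ[R] M} {g : M →ₗ[R] N}

/-- The connecting map of the long exact sequence of `Ext` into the residue field. -/
noncomputable abbrev ExtResidueField.δ (hf : Function.Injective f)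
    (hfg : Function.Exact f g) (hg : Function.Surjective g) (n : ℕ) :
    ExtResidueField R L n →ₗ[R] ExtResidueField R N (n + 1) :=
  (ModuleCat.shortExact_of_linearMap hf hfg hg).extClass.precompOfLinear R _ (add_comm 1 n)

variable (hf : Function.Injective f) (hfg : Function.Exact f g) (hg : Function.Surjective g)

include hf hfg hg in
theorem ExtResidueField.exists_map_of_map_eq_zero {n : ℕ} (x : ExtResidueField R M n)
    (hx : ExtResidueField.map f n x = 0) : ∃ y, ExtResidueField.map g n y = x :=
  Abelian.Ext.contravariant_sequence_exact₂ (ModuleCat.shortExact_of_linearMap hf hfg hg) _ x hx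

theorem ExtResidueField.exists_map_of_δ_eq_zero {n : ℕ} (x : ExtResidueField R L n)
    (hx : ExtResidueField.δ hf hfg hg n x = 0) : ∃ y, ExtResidueField.map f n y = x :=
  Abelian.Ext.contravariant_sequence_exact₁ (ModuleCat.shortExact_of_linearMap hf hfg hg) _ x (add_comm 1 n) hx

theorem ExtResidueField.exists_δ_of_map_eq_zero {n : ℕ} (x : ExtResidueField R N (n + 1))
    (hx : ExtResidueField.map g (n + 1) x = 0) : ∃ y, ExtResidueField.δ hf hfg hg n y = x :=
  Abelian.Ext.contravariant_sequence_exact₃ (ModuleCat.shortExact_of_linearMap hf hfg hg) _ x hx (add_comm 1 n)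

end ShortExact

theorem ExtResidueField.subsingleton_of_projective (M : Type u) [AddCommGroup M] [Module R M]
    [Module.Projective R M] (n : ℕ) : Subsingleton (ExtResidueField R M (n + 1)) :=
  Abelian.Ext.subsingleton_of_projective _ _ n

/-- Dimension shifting along a finite free cover. Finiteness matters because `finrank` is $0$ on
infinite-dimensional spaces. -/
theorem ExtResidueField.finite_ring [IsNoetherianRing R] (M : Type u) [AddCommGroup M] [Module R M]
    [Module.Finite R M] (n : ℕ) : Module.Finite R (ExtResidueField R M n) := by
  induction n generalizing M with
  | zero =>
    have : Module.Finite R (M →ₗ[R] ResidueField R) :=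
      inferInstance
    exact Module.Finite.equiv ((Abelian.Ext.linearEquiv₀ (R := R)).trans
      (ModuleCat.homLinearEquiv (S := R))).symm
  | succ n ih =>
    obtain ⟨m, f, hf⟩ := Module.Finite.exists_fin' R M
    have := ih (LinearMap.ker f)
    refine Module.Finite.of_surjective (ExtResidueField.δ (LinearMap.ker f).injective_subtype
      (LinearMap.exact_subtype_ker_map f) hf n) fun x ↦
        ExtResidueField.exists_δ_of_map_eq_zero _ _ _ x ?_
    have := ExtResidueField.subsingleton_of_projective (R := R) (Fin m → R) n
    exact Subsingleton.elim _ _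

instance ExtResidueField.finite [IsNoetherianRing R] (M : Type u) [AddCommGroup M] [Module R M]
    [Module.Finite R M] (n : ℕ) : Module.Finite (ResidueField R) (ExtResidueField R M n) :=
  have := ExtResidueField.finite_ring (R := R) M n
  Module.Finite.of_restrictScalars_finite R (ResidueField R) _

variable {L M N : Type u} [AddCommGroup L] [Module R L] [AddCommGroup M] [Module R M]
  [AddCommGroup N] [Module R N]
  {f : L →ₗ[R] M} {g : M →ₗ[R] N}

theorem bettiNumber_le_of_exact [IsNoetherianRing R] [Module.Finite R L] [Module.Finite R M] [Module.Finite R N]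
    (hf : Function.Injective f) (hfg : Function.Exact f g)
    (hg : Function.Surjective g) (n : ℕ) :
    bettiNumber R M n ≤ bettiNumber R N n + bettiNumber R L n :=
  finrank_le_add_of_exact IsLocalRing.residue_surjective (ExtResidueField.map g n)
    (ExtResidueField.map f n) (ExtResidueField.exists_map_of_map_eq_zero hf hfg hg)

theorem bettiNumber_succ_le_of_projective [IsNoetherianRing R] [Module.Finite R L]
    (hf : Function.Injective f) (hfg : Function.Exact f g)
    (hg : Function.Surjective g) [Module.Projective R M] (n : ℕ) :
    bettiNumber R N (n + 1) ≤ bettiNumber R L n :=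
  have := ExtResidueField.subsingleton_of_projective (R := R) M n
  finrank_le_of_surjective_of_algebraMap_surjective IsLocalRing.residue_surjective
    (ExtResidueField.δ hf hfg hg n)
    fun x ↦ ExtResidueField.exists_δ_of_map_eq_zero hf hfg hg x (Subsingleton.elim _ _)

/-- The degree starts at $n+1$ because in degree $0$ the term $\operatorname{Hom}(M,k)$ need not
vanish, so $\delta$ need not be injective there. -/
theorem bettiNumber_le_succ_of_projective [IsNoetherianRing R] [Module.Finite R N]
    (hf : Function.Injective f) (hfg : Function.Exact f g)
    (hg : Function.Surjective g) [Module.Projective R M] (n : ℕ) :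
    bettiNumber R L (n + 1) ≤ bettiNumber R N (n + 2) := by
  have := ExtResidueField.subsingleton_of_projective (R := R) M n
  refine finrank_le_of_injective_of_algebraMap_surjective IsLocalRing.residue_surjective
    (ExtResidueField.δ hf hfg hg (n + 1)) ((injective_iff_map_eq_zero _).2 fun x hx ↦ ?_)
  obtain ⟨y, rfl⟩ := ExtResidueField.exists_map_of_δ_eq_zero hf hfg hg x hx
  rw [Subsingleton.elim y 0, map_zero]

/-- If `g` factors through the kernel `L` of `g`, then the Betti numbers of the image of `g` are
bounded by those of `L`. -/
theorem bettiNumber_succ_le_of_factorization [IsNoetherianRing R] [Module.Finite R L] [Module.Finite R N]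
    (hf : Function.Injective f)
    (hfg : Function.Exact f g) (hg : Function.Surjective g) (p : M →ₗ[R] L) (q : L →ₗ[R] N)
    (hpq : q ∘ₗ p = g) (n : ℕ) :
    bettiNumber R N (n + 1) ≤ bettiNumber R L n + bettiNumber R L (n + 1) :=
  -- By contravariance $g^*=p^*q^*$, so $\ker q^*\subseteq\ker g^*=\operatorname{im}\delta$.
  finrank_le_add_of_exact IsLocalRing.residue_surjective (ExtResidueField.δ hf hfg hg n)
    (ExtResidueField.map q (n + 1)) fun x hx ↦
      ExtResidueField.exists_δ_of_map_eq_zero hf hfg hg x (by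
        rw [← hpq, ExtResidueField.map_comp_apply, hx, map_zero])

theorem bettiNumber_congr [IsNoetherianRing R] [Module.Finite R M] [Module.Finite R N]
    (e : M ≃ₗ[R] N) (n : ℕ) : bettiNumber R M n = bettiNumber R N n := by
  have key {P Q : Type u} [AddCommGroup P] [Module R P] [AddCommGroup Q] [Module R Q]
      [Module.Finite R P] [Module.Finite R Q] (e : P ≃ₗ[R] Q) :
      bettiNumber R P n ≤ bettiNumber R Q n := by
    refine finrank_le_of_surjective_of_algebraMap_surjective IsLocalRing.residue_surjective
      (ExtResidueField.map e.toLinearMap n) fun x ↦ ⟨ExtResidueField.map e.symm.toLinearMap n x, ?_⟩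
    rw [← ExtResidueField.map_comp_apply, LinearEquiv.symm_comp]
    simp [ExtResidueField.map]
  exact (key e).antisymm (key e.symm)

theorem bettiNumber_eq_zero_of_subsingleton [Subsingleton M] (n : ℕ) : bettiNumber R M n = 0 := by
  have : Subsingleton (ExtResidueField R M n) := by
    refine subsingleton_of_forall_eq 0 fun x ↦ ?_
    calc
      x = ExtResidueField.map (LinearMap.id : M →ₗ[R] M) n x :=
        (Abelian.Ext.mk₀_id_comp x).symm
      _ = ExtResidueField.map (0 : M →ₗ[R] M) n x := by
        rw [Subsingleton.elim (LinearMap.id : M →ₗ[R] M) 0]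
      _ = 0 := by simp [ExtResidueField.map, ModuleCat.ofHom_zero]
  exact Module.finrank_zero_of_subsingleton

/-- The Betti numbers of a module annihilated by a power of the maximal ideal are bounded by a
constant multiple of those of the residue field. -/
theorem exists_bettiNumber_le_mul [IsNoetherianRing R] (M : Type u) [AddCommGroup M] [Module R M]
    [Module.Finite R M]    {j : ℕ} (hM : maximalIdeal R ^ j ≤ Module.annihilator R M) :
    ∃ C : ℕ, ∀ n, bettiNumber R M n ≤ C * bettiNumber R (ResidueField R) n := by
  revert hM
  refine IsNoetherianRing.induction_on_isQuotientEquivQuotientPrime R (M := M) inferInstance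
    (motive := fun M _ _ _ ↦ maximalIdeal R ^ j ≤ Module.annihilator R M →
      ∃ C : ℕ, ∀ n, bettiNumber R M n ≤ C * bettiNumber R (ResidueField R) n) ?_ ?_ ?_
  · intro N _ _ _ _ _
    exact ⟨0, fun n ↦ by simp [bettiNumber_eq_zero_of_subsingleton]⟩
  · intro N _ _ _ p e hN
    rw [e.annihilator_eq, Ideal.annihilator_quotient] at hN
    -- A prime containing $\mathfrak m^j$ is $\mathfrak m$, so every factor of a prime filtration is
    -- $k$.
    have hp : p.1 = maximalIdeal R :=
      ((maximalIdeal.isMaximal R).eq_of_le p.2.ne_top (p.2.le_of_pow_le hN)).symm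
    exact ⟨1, fun n ↦ (bettiNumber_congr (e.trans (Submodule.quotEquivOfEq _ _ hp)) n).le.trans
      (one_mul _).ge⟩
  · intro N₁ _ _ _ N₂ _ _ _ N₃ _ _ _ f g hf hg hfg h₁ h₃ h
    obtain ⟨C₁, h₁⟩ := h₁ (h.trans (f.annihilator_le_of_injective hf))
    obtain ⟨C₃, h₃⟩ := h₃ (h.trans (g.annihilator_le_of_surjective hg))
    refine ⟨C₃ + C₁, fun n ↦ (bettiNumber_le_of_exact hf hfg hg n).trans ?_⟩
    rw [add_mul]
    exact add_le_add (h₃ n) (h₁ n)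

end Betti

/-! ### From Betti number inequalities to complexity and curvature. -/

section Growth

variable {R : Type u} [CommRing R] [IsLocalRing R] {M N : Type u} [AddCommGroup M] [Module R M]
  [AddCommGroup N] [Module R N]

/-- Shifting the index by at most one changes `n ^ (b - 1)` by at most a constant factor. -/
theorem zpow_sub_one_le_of_le_two_mul {m n : ℕ} (b : ℕ) (hm : 0 < m) (hmn : m ≤ 2 * n)
    (hnm : n ≤ 2 * m) :
    (m : ℝ) ^ ((b : ℤ) - 1) ≤ 2 ^ (b + 1) * (n : ℝ) ^ ((b : ℤ) - 1) := by
  have hn : 0 < n := by omega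
  have hm' : (0 : ℝ) < m := by exact_mod_cast hm
  have hn' : (0 : ℝ) < n := by exact_mod_cast hn
  have hmn' : (m : ℝ) ≤ 2 * n := by exact_mod_cast hmn
  have hnm' : (n : ℝ) ≤ 2 * m := by exact_mod_cast hnm
  -- For $b=0$ the exponent is $-1$ and the bound comes from $n\le 2m$; otherwise it comes from
  -- $m\le 2n$.
  rcases b with _ | b
  · simp only [Nat.cast_zero, zero_sub, zpow_neg, zpow_one, zero_add, pow_one]
    rw [inv_le_iff_one_le_mul₀ hm', mul_right_comm, ← div_eq_mul_inv, one_le_div hn']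
    exact hnm'
  · simp only [Nat.cast_add, Nat.cast_one, add_sub_cancel_right, zpow_natCast]
    calc (m : ℝ) ^ b ≤ (2 * n) ^ b := by gcongr
      _ = 2 ^ b * n ^ b := mul_pow _ _ _
      _ ≤ 2 ^ (b + 1 + 1) * n ^ b := by gcongr <;> norm_num; omega

/-- The three-term window accommodates the index shifts of both comparisons between $I$ and $k$. -/
theorem complexity_le_of_bettiNumber_le {C : ℕ}
    (h : ∀ n, bettiNumber R N (n + 2) ≤
      C * (bettiNumber R M (n + 1) + bettiNumber R M (n + 2) + bettiNumber R M (n + 3))) :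
    complexity R N ≤ complexity R M := by
  -- `C + 1` keeps the constant positive when $C=0$; $3$ counts the terms and $2^{b+1}$ absorbs the
  -- index shift.
  refine le_iInf₂ fun b ⟨α, hα, hb⟩ ↦ iInf₂_le b ⟨(C + 1) * (3 * (α * 2 ^ (b + 1))), by positivity, ?_⟩
  obtain ⟨n₀, hn₀⟩ := eventually_atTop.1 hb
  refine eventually_atTop.2 ⟨n₀ + 2, fun n hn ↦ ?_⟩
  obtain ⟨n, rfl⟩ : ∃ l, n = l + 2 := ⟨n - 2, by omega⟩
  have key (m : ℕ) (hm : n + 1 ≤ m) (hm' : m ≤ n + 3) :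
      (bettiNumber R M m : ℝ) ≤ α * 2 ^ (b + 1) * ((n + 2 : ℕ) : ℝ) ^ ((b : ℤ) - 1) := by
    refine (hn₀ m (by omega)).trans ?_
    rw [mul_assoc]
    gcongr
    exact zpow_sub_one_le_of_le_two_mul b (by omega) (by omega) (by omega)
  have h1 := key (n + 1) (by omega) (by omega)
  have h2 := key (n + 2) (by omega) (by omega)
  have h3 := key (n + 3) (by omega) (by omega)
  have h4 : (bettiNumber R N (n + 2) : ℝ) ≤
      C * (bettiNumber R M (n + 1) + bettiNumber R M (n + 2) + bettiNumber R M (n + 3)) := by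
    exact_mod_cast h n
  refine h4.trans ?_
  set t := α * 2 ^ (b + 1) * ((n + 2 : ℕ) : ℝ) ^ ((b : ℤ) - 1) with ht
  calc (C : ℝ) * (bettiNumber R M (n + 1) + bettiNumber R M (n + 2) + bettiNumber R M (n + 3))
      ≤ (C + 1) * (t + t + t) := by gcongr; linarith
    _ = _ := by rw [ht]; ring

/-- A sequence bounded by a constant multiple of `t ^ n` has exponential growth rate at most
`t`. -/
theorem ENNReal.limsup_rpow_one_div_le {c : ℕ → ENNReal} {D t : ENNReal} (hD : D ≠ ⊤)
    (h : ∀ᶠ n in atTop, c n ≤ D * t ^ n) :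
    limsup (fun n : ℕ ↦ c n ^ (1 / (n : ℝ))) atTop ≤ t := by
  -- This excludes $D=0$, where $D^{1/n}\to 1$ fails.
  wlog hD0 : 1 ≤ D generalizing D
  · refine this (D := max D 1) (by simp [hD]) ?_ (le_max_right _ _)
    filter_upwards [h] with n hn
    exact hn.trans (by gcongr; exact le_max_left _ _)
  by_cases htop : t = ⊤
  · simp [htop]
  have hlim : Tendsto (fun n : ℕ ↦ D ^ (1 / (n : ℝ)) * t) atTop (nhds t) := by
    lift D to NNReal using hD
    have hD1 : D ≠ 0 := (zero_lt_one.trans_le (by exact_mod_cast hD0)).ne'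
    have h0 : Tendsto (fun n : ℕ ↦ (D : ENNReal) ^ (1 / (n : ℝ))) atTop (nhds 1) := by
      have h1 := (NNReal.continuousAt_rpow (x := D) (y := 0) (Or.inl hD1)).tendsto.comp
        (tendsto_const_nhds.prodMk_nhds (tendsto_one_div_atTop_nhds_zero_nat (𝕜 := ℝ)))
      rw [NNReal.rpow_zero] at h1
      simpa [Function.comp_def, ENNReal.coe_rpow_of_ne_zero hD1] using ENNReal.tendsto_coe.2 h1
    simpa using ENNReal.Tendsto.mul_const h0 (Or.inr htop)
  rw [← hlim.limsup_eq]
  refine limsup_le_limsup ?_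
  filter_upwards [h, eventually_gt_atTop 0] with n hn hn0
  have hn1 : (n : ℝ) ≠ 0 := by positivity
  calc c n ^ (1 / (n : ℝ)) ≤ (D * t ^ n) ^ (1 / (n : ℝ)) :=
        ENNReal.rpow_le_rpow hn (by positivity)
    _ = D ^ (1 / (n : ℝ)) * t := by
        rw [ENNReal.mul_rpow_of_nonneg _ _ (by positivity), ← ENNReal.rpow_natCast,
          ← ENNReal.rpow_mul, mul_one_div_cancel hn1, ENNReal.rpow_one]

theorem curvature_le_of_bettiNumber_le {C : ℕ}
    (h : ∀ n, bettiNumber R N (n + 2) ≤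
      C * (bettiNumber R M (n + 1) + bettiNumber R M (n + 2) + bettiNumber R M (n + 3))) :
    curvature R N ≤ curvature R M := by
  refine le_of_forall_gt_imp_ge_of_dense fun t ht ↦ ?_
  by_cases htop : t = ⊤
  · simp [htop]
  have ht0 : t ≠ 0 := (zero_le.trans_lt ht).ne'
  obtain ⟨n₀, hn₀⟩ := eventually_atTop.1 (eventually_lt_of_limsup_lt ht)
  have key (m : ℕ) (hm : n₀ + 1 ≤ m) : (bettiNumber R M m : ENNReal) ≤ t ^ m := by
    have hm0 : (0 : ℝ) < m := by exact_mod_cast (by omega : 0 < m)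
    have := ENNReal.rpow_le_rpow (hn₀ m (by omega)).le hm0.le
    rwa [← ENNReal.rpow_mul, one_div_mul_cancel hm0.ne', ENNReal.rpow_one,
      ENNReal.rpow_natCast] at this
  -- For $t$ above the curvature of $M$, eventually $\beta_m\le t^m$, and
  -- $t^{n+1}+t^{n+2}+t^{n+3}=(t^{-1}+1+t)\,t^{n+2}$.
  refine ENNReal.limsup_rpow_one_div_le (D := C * (t⁻¹ + 1 + t)) (by finiteness) ?_
  refine eventually_atTop.2 ⟨n₀ + 2, fun n hn ↦ ?_⟩
  obtain ⟨n, rfl⟩ : ∃ l, n = l + 2 := ⟨n - 2, by omega⟩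
  calc (bettiNumber R N (n + 2) : ENNReal)
      ≤ C * (bettiNumber R M (n + 1) + bettiNumber R M (n + 2) + bettiNumber R M (n + 3)) := by
        exact_mod_cast h n
    _ ≤ C * (t ^ (n + 1) + t ^ (n + 2) + t ^ (n + 3)) := by
        gcongr <;> exact key _ (by omega)
    _ = C * (t⁻¹ * t * t ^ (n + 1) + t ^ (n + 2) + t ^ (n + 3)) := by
        rw [ENNReal.inv_mul_cancel ht0 htop, one_mul]
    _ = C * (t⁻¹ + 1 + t) * t ^ (n + 2) := by ring

end Growth

/-! ### The determinant trick and the Burch condition. -/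

section IntegrallyClosed

variable {R : Type u} [CommRing R]

open Polynomial in
/-- If `r` belongs to a finitely generated ideal `J` with `r • J ≤ I * J`, then `r` is integral
over `I`. -/
theorem isIntegralOverIdeal_of_mul_mem {I J : Ideal R} (hJ : J.FG) {r : R} (hr : r ∈ J)
    (h : ∀ z ∈ J, r * z ∈ I * J) : IsIntegralOverIdeal I r := by
  have : Module.Finite R J := Module.Finite.iff_fg.2 hJ
  let f : Module.End R J := algebraMap R _ r
  have hf : LinearMap.range f ≤ I • ⊤ := by
    rintro _ ⟨z, rfl⟩
    have hz : (f z : R) ∈ (I • (⊤ : Submodule R J)).map J.subtype := by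
      rw [Submodule.map_smul'', Submodule.map_subtype_top]
      exact h z z.2
    obtain ⟨w, hw, hwz⟩ := hz
    have hwz : w = f z := Subtype.ext hwz
    exact hwz ▸ hw
  obtain ⟨p, hp, -, hcoeff, hroot⟩ :=
    f.exists_monic_and_natDegree_eq_and_coeff_mem_pow_and_aeval_eq_zero R I hf
  -- Cayley–Hamilton says that $p(r)$ kills $J$. Since $J$ need not be faithful, evaluate at $r\in
  -- J$: the integral equation is $p(r)\,r=0$, of degree one more and with zero constant term.
  have hroot' : p.eval r * r = 0 := by
    have h1 : aeval f p = algebraMap R (Module.End R J) (p.eval r) := by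
      rw [aeval_algebraMap_apply_eq_algebraMap_eval]
    rw [hroot] at h1
    have h2 := congrArg (Subtype.val) (LinearMap.congr_fun h1 ⟨r, hr⟩)
    simpa [Module.algebraMap_end_apply] using h2.symm
  refine ⟨p.natDegree + 1, by omega,
    fun i ↦ if i ≤ p.natDegree then p.coeff (p.natDegree - i) else 0, fun i hi ↦ ?_, ?_⟩
  · dsimp only
    split_ifs with h
    · simpa [Nat.sub_sub_self h] using hcoeff (p.natDegree - i)
    · exact zero_mem _
  · rw [eval_eq_sum_range, ← Finset.sum_range_reflect, Finset.sum_range_succ', add_mul] at hroot'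
    simp only [Nat.add_sub_cancel, Nat.sub_zero, hp.coeff_natDegree, one_mul, ← pow_succ] at hroot'
    dsimp only
    rw [Finset.sum_Icc_succ_top (by omega), if_neg (by omega), zero_mul, add_zero]
    refine Eq.trans ?_ hroot'
    rw [add_comm]
    congr 1
    rw [Finset.sum_mul]
    refine (Finset.sum_bij (fun i _ ↦ i + 1) (fun i hi ↦ ?_) (fun _ _ _ _ h ↦ by omega)
      (fun i hi ↦ ?_) fun i hi ↦ ?_).symm
    · simp at hi ⊢
      omega
    · rw [Finset.mem_Icc] at hi
      exact ⟨i - 1, by simp; omega, by omega⟩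
    · have hi := Finset.mem_range.1 hi
      rw [if_pos (by omega), mul_assoc, ← pow_succ]
      congr 2
      omega

variable [IsLocalRing R] [IsNoetherianRing R]

theorem IsIntegrallyClosedIdeal.mem_of_mul_maximalIdeal_le {I : Ideal R}
    (hI : IsIntegrallyClosedIdeal I) (hI' : I ≤ maximalIdeal R) (hm : maximalIdeal R ≠ ⊥) {r : R}
    (h : ∀ z ∈ maximalIdeal R, r * z ∈ I * maximalIdeal R) : r ∈ I := by
  by_cases hr : r ∈ maximalIdeal R
  · exact hI r (isIntegralOverIdeal_of_mul_mem (maximalIdeal R).fg_of_isNoetherianRing hr h)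
  · have hr : IsUnit r := by simpa using hr
    refine (hm (Submodule.eq_bot_of_le_smul_of_le_jacobson_bot (maximalIdeal R) _
      (maximalIdeal R).fg_of_isNoetherianRing (fun z hz ↦ ?_)
      (maximalIdeal_le_jacobson _))).elim
    exact Ideal.mul_mono_left hI' ((Ideal.unit_mul_mem_iff_mem _ hr).1 (h z hz))

/-- A proper integrally closed ideal containing a power of a nonzero maximal ideal satisfies the
Burch condition. -/
theorem IsIntegrallyClosedIdeal.exists_mul_notMem {I : Ideal R}
    (hI : IsIntegrallyClosedIdeal I) (hI' : I ≤ maximalIdeal R) (hm : maximalIdeal R ≠ ⊥) {j : ℕ}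
    (hj : maximalIdeal R ^ j ≤ I) :
    ∃ y, (∀ z ∈ maximalIdeal R, y * z ∈ I) ∧
      ∃ x ∈ maximalIdeal R, y * x ∉ I * maximalIdeal R := by
  classical
  have hex : ∃ j, maximalIdeal R ^ j ≤ I := ⟨j, hj⟩
  obtain ⟨l, hl⟩ : ∃ l, Nat.find hex = l + 1 := by
    refine Nat.exists_eq_succ_of_ne_zero fun h0 ↦ ?_
    have h1 := Nat.find_spec hex
    rw [h0, pow_zero, Ideal.one_eq_top] at h1
    exact (maximalIdeal.isMaximal R).ne_top (top_le_iff.1 (h1.trans hI'))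
  obtain ⟨y, hy, hyI⟩ := SetLike.not_le_iff_exists.1 (Nat.find_min hex (m := l) (by omega))
  refine ⟨y, fun z hz ↦ Nat.find_spec hex ?_, ?_⟩
  · rw [hl, pow_succ]
    exact Ideal.mul_mem_mul hy hz
  · by_contra! h
    exact hyI (hI.mem_of_mul_maximalIdeal_le hI' hm h)

end IntegrallyClosed

/-! ### The Burch condition bounds the Betti numbers of the residue field. -/

section Burch

variable {R : Type u} [CommRing R] [IsLocalRing R]

/-- Outside `𝔪 I` there are linear forms on `I` with values in the residue field that do not
vanish. -/
theorem exists_linearMap_residueField_ne_zero {M : Type u} [AddCommGroup M] [Module R M] {w : M}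
    (hw : w ∉ maximalIdeal R • (⊤ : Submodule R M)) :
    ∃ φ : M →ₗ[R] ResidueField R, φ w ≠ 0 := by
  let V := M ⧸ maximalIdeal R • (⊤ : Submodule R M)
  let _ : Module (ResidueField R) V := Module.instQuotientIdealSubmoduleHSMulTop M (maximalIdeal R)
  have : IsScalarTower R (ResidueField R) V :=
    inferInstanceAs (IsScalarTower R (R ⧸ maximalIdeal R) V)
  obtain ⟨φ, hφ⟩ := Module.Projective.exists_dual_ne_zero (ResidueField R)
    (x := (Submodule.Quotient.mk w : V)) (by simpa [V, Submodule.Quotient.mk_eq_zero] using hw)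
  exact ⟨φ.restrictScalars R ∘ₗ Submodule.mkQ _, hφ⟩

variable [IsNoetherianRing R]

/-- The Betti numbers of a Burch ideal dominate those of the residue field. -/
theorem bettiNumber_residueField_succ_le_of_burch {I : Ideal R} {y x : R}
    (hy : ∀ z ∈ maximalIdeal R, y * z ∈ I) (hx : x ∈ maximalIdeal R)
    (hyx : y * x ∉ I * maximalIdeal R) (n : ℕ) :
    bettiNumber R (ResidueField R) (n + 1) ≤ bettiNumber R I n + bettiNumber R I (n + 1) := by
  let J : Ideal R := Ideal.span {y} ⊔ I
  have hJI : ∀ z ∈ J, x * z ∈ I := by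
    intro z hz
    obtain ⟨a, i, hi, rfl⟩ := Ideal.mem_span_singleton_sup.1 hz
    rw [show x * (a * y + i) = a * (y * x) + x * i by ring]
    exact I.add_mem (I.mul_mem_left a (hy x hx)) (I.mul_mem_left x hi)
  let p : J →ₗ[R] I := (LinearMap.lsmul R R x).restrict hJI
  have hw : (⟨y * x, hy x hx⟩ : I) ∉ maximalIdeal R • (⊤ : Submodule R I) := fun h ↦ hyx (by
    have := Submodule.mem_map_of_mem (f := I.subtype) h
    rwa [Submodule.map_smul'', Submodule.map_subtype_top, smul_eq_mul, mul_comm] at this)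
  obtain ⟨φ, hφ⟩ := exists_linearMap_residueField_ne_zero hw
  have hyJ : y ∈ J := Ideal.mem_sup_left (Ideal.mem_span_singleton_self y)
  have hpy : φ (p ⟨y, hyJ⟩) ≠ 0 := by
    have : p ⟨y, hyJ⟩ = ⟨y * x, hy x hx⟩ := Subtype.ext (mul_comm x y)
    rwa [this]
  -- On $I$ the composite is $x\varphi$, which vanishes because $x\in\mathfrak m$ kills $k$.
  have hker (i : I) : φ (p (Submodule.inclusion le_sup_right i)) = 0 := by
    have : p (Submodule.inclusion le_sup_right i) = x • i := rfl
    rw [this, map_smul, Algebra.smul_def]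
    have : algebraMap R (ResidueField R) x = 0 := (residue_eq_zero_iff x).2 hx
    rw [this, zero_mul]
  refine bettiNumber_succ_le_of_factorization (M := J)
    (f := Submodule.inclusion le_sup_right) (g := φ ∘ₗ p)
    (Submodule.inclusion_injective _) ?_ ?_ p φ rfl n
  · intro z
    refine ⟨fun hz ↦ ?_, ?_⟩
    -- The element $ay+i$ maps to $\bar a\,\varphi(xy)$, so in the kernel $a\in\mathfrak m$ and
    -- hence $ay\in I$.
    · obtain ⟨a, i, hi, hz'⟩ := Ideal.mem_span_singleton_sup.1 z.2
      have hz' : z = a • ⟨y, hyJ⟩ + Submodule.inclusion le_sup_right (⟨i, hi⟩ : I) :=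
        Subtype.ext hz'.symm
      have ha : a ∈ maximalIdeal R := by
        rw [← residue_eq_zero_iff]
        have h : residue R a * φ (p ⟨y, hyJ⟩) = 0 := by
          rw [hz', map_add, LinearMap.comp_apply, LinearMap.comp_apply, hker, add_zero, map_smul,
            map_smul] at hz
          exact hz
        exact (mul_eq_zero.1 h).resolve_right hpy
      refine ⟨⟨z, ?_⟩, rfl⟩
      rw [hz']
      exact I.add_mem (by simpa [mul_comm] using hy a ha) hi
    · rintro ⟨i, rfl⟩
      exact hker i
  · intro c
    obtain ⟨a, ha⟩ := residue_surjective (c / φ (p ⟨y, hyJ⟩))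
    refine ⟨a • ⟨y, hyJ⟩, ?_⟩
    rw [map_smul, Algebra.smul_def]
    change residue R a * φ (p ⟨y, hyJ⟩) = c
    rw [ha, div_mul_cancel₀ _ hpy]

end Burch

/-! ### The two comparisons combined. -/

theorem mainTheorem1 (R : Type u) [CommRing R] [IsLocalRing R] [IsNoetherianRing R]
    (I : Ideal R) (hprim : I.IsPrimary) (hrad : I.radical = maximalIdeal R)
    (hclosed : IsIntegrallyClosedIdeal I) :
    complexity R I = complexity R (ResidueField R) ∧
      curvature R I = curvature R (ResidueField R) := by
  obtain ⟨j, hj⟩ := I.exists_radical_pow_le_of_fg (I.radical.fg_of_isNoetherianRing)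
  rw [hrad] at hj
  have hI : I ≤ maximalIdeal R := le_maximalIdeal hprim.ne_top
  obtain ⟨C, hC⟩ := exists_bettiNumber_le_mul (R ⧸ I) (j := j) (by rwa [Ideal.annihilator_quotient])
  have hupper (n : ℕ) : bettiNumber R I (n + 2) ≤ C *
      (bettiNumber R (ResidueField R) (n + 1) + bettiNumber R (ResidueField R) (n + 2) +
        bettiNumber R (ResidueField R) (n + 3)) :=
    (bettiNumber_le_succ_of_projective I.injective_subtype (LinearMap.exact_subtype_mkQ I)
      I.mkQ_surjective (n + 1)).trans ((hC _).trans (by gcongr; exact Nat.le_add_left _ _))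
  have hlower (n : ℕ) : bettiNumber R (ResidueField R) (n + 2) ≤ 1 *
      (bettiNumber R I (n + 1) + bettiNumber R I (n + 2) + bettiNumber R I (n + 3)) := by
    -- The Burch argument needs $\mathfrak m\ne 0$; otherwise $I=\mathfrak m$ is itself a syzygy of
    -- $k$.
    by_cases hm : maximalIdeal R = ⊥
    · have hIm : I = maximalIdeal R := by rw [hm] at hI ⊢; exact le_bot_iff.1 hI
      have := bettiNumber_succ_le_of_projective (maximalIdeal R).injective_subtype
        (LinearMap.exact_subtype_mkQ _) (maximalIdeal R).mkQ_surjective (n + 1)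
      rw [hIm]
      change bettiNumber R (R ⧸ maximalIdeal R) (n + 2) ≤ _
      exact this.trans (by omega)
    · obtain ⟨y, hy, x, hx, hyx⟩ := hclosed.exists_mul_notMem hI hm hj
      have := bettiNumber_residueField_succ_le_of_burch hy hx hyx (n + 1)
      rw [one_mul]
      exact this.trans (Nat.le_add_right _ _)
  exact ⟨(complexity_le_of_bettiNumber_le hupper).antisymm (complexity_le_of_bettiNumber_le hlower),
    (curvature_le_of_bettiNumber_le hupper).antisymm (curvature_le_of_bettiNumber_le hlower)⟩
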